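/- Let $\Omega\subset\mathbb R^d$ be a bounded Lipschitz domain (or, more generally, any open set, in any dimension $d$), let $0<\alpha<1$, $T>0$, $\lambda\in\mathbb R$, let $\langle\cdot,\cdot\rangle$ and $\|\cdot\|$ be the inner product and norm of $L_2(\Omega)$, and let $\mathcal L$ be a linear second-order elliptic operator in weak form (or, more generally, any bounded linear operator $\mathcal L:H_0^1(\Omega)\to H^{-1}(\Omega)$) such that $\langle \mathcal L v,v\rangle\ge\lambda\|v\|^2$ for all $v\in H_0^1(\Omega)$. Denote by $$D_t^\alpha v(t)=J_t^{1-\alpha}(\partial_t v)(t)=\frac1{\Gamma(1-\alpha)}\int_0^t (t-s)^{-\alpha}\,\partial_s v(s)\,ds,\qquad t>0,$$ the Caputo derivative; for functions that may be discontinuous, or have a non-integrable derivative, at $t=0$ it is understood as $$D_t^\alpha v(t)=\frac1{\Gamma(1-\alpha)}\lim_{\varepsilon\to0^+}\Bigl[t^{-\alpha}\bigl(v(\varepsilon)-v(0)\bigr)+\int_\varepsilon^t (t-s)^{-\alpha}\,\partial_s v(s)\,ds\Bigr].$$ Let $f(\cdot,t)\in H^{-1}(\Omega)$ for $0<t\le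 T$ and $u_0\in L_2(\Omega)$. Let $u,u_h:[0,T]\to L_2(\Omega)$ both belong to $L_\infty(0,t;L_2(\Omega))\cap W^{1,\infty}(\varepsilon,t;L_2(\Omega))$ for all $0<\varepsilon<t\le T$, with $u(\cdot,t),u_h(\cdot,t)\in H_0^1(\Omega)$ for all $t\in(0,T]$. Suppose that $u$ solves $$D_t^\alpha u+\mathcal L u=f\ \text{ for } t\in(0,T],\qquad u(\cdot,0)=u_0,$$ that $u_h(\cdot,0)=u_0$, and that the residual $R_h(\cdot,t):=(D_t^\alpha+\mathcal L)u_h(\cdot,t)-f(\cdot,t)$ is in $L_2(\Omega)$ for all $t\in(0,T]$ (both equations being understood in $H^{-1}(\Omega)$). Let $\mathcal E:[0,T]\to[0,\infty)$ be a function that is absolutely continuous on $[\varepsilon,T]$ for every $0<\varepsilon\le T$ (a jump at $t=0$ is allowed) and whose Caputo derivative $D_t^\alpha\mathcal E(t)$ exists for all $t\in(0,T]$. If $$\|R_h(\cdot,t)\|\le (D_t^\alpha+\lambda)\,\mathcal E(t)\qquad\text{for all } t\in(0,T],$$ then $$\|(u_h-u)(\cdot,t)\|\le\mathcal E(t)\qquad\text{for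 all } t\in[0,T].$$ -/

import Mathlib

open Set Filter Topology MeasureTheory
open scoped InnerProductSpace ContDiff ENNReal

noncomputable section

/-! ### Fractional calculus in time, for functions with values in a Banach space -/

section Time

variable {X : Type*} [NormedAddCommGroup X] [NormedSpace ℝ X]

/-- The Riemann-Liouville fractional integral
`J_t^β v (t) = Γ(β)⁻¹ ∫_0^t (t - s)^(β - 1) v(s) ds`. -/
def fracIntegral (β : ℝ) (v : ℝ → X) (t : ℝ) : X :=
  (Real.Gamma β)⁻¹ • ∫ s in (0 : ℝ)..t, (t - s) ^ (β - 1) • v s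

/-- The integral `J_t^{1-α} (∂_t v)` at time `t`, with the part of it over the initial interval
`[0, ε]` replaced by the contribution of the increment `v(ε) - v(0)` concentrated at time `0`. -/
def caputoTrunc (α : ℝ) (v : ℝ → X) (t ε : ℝ) : X :=
  (Real.Gamma (1 - α))⁻¹ •
    (t ^ (-α) • (v ε - v 0) + ∫ s in ε..t, (t - s) ^ (-α) • deriv v s)

/-- `d` is the Caputo derivative of order `α` of `v` at the time `t > 0`, that is,
`d = J_t^{1-α} (∂_t v) (t)`.  The integral is taken as a limit of integrals over `(ε, t)`, and
`∂_t v` is the derivative of `v` on `[0, t)`, which contains the point mass `(v(0+) - v(0)) δ`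
at time `0` if `v` jumps there.  If `v` is right-continuous at `0` and the integral is
absolutely convergent, this is the usual formula, see `hasCaputoDeriv_fracIntegral`. -/
def HasCaputoDeriv (α : ℝ) (v : ℝ → X) (t : ℝ) (d : X) : Prop :=
  (∀ ε ∈ Ioo 0 t, IntervalIntegrable (fun s => (t - s) ^ (-α) • deriv v s) volume ε t) ∧
    Tendsto (caputoTrunc α v t) (𝓝[>] 0) (𝓝 d)

/-- The Caputo derivative `D_t^α v (t)` (meaningful where some `d` satisfies
`HasCaputoDeriv α v t d`). -/
def caputoDeriv (α : ℝ) (v : ℝ → X) (t : ℝ) : X :=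
  limUnder (𝓝[>] 0) (caputoTrunc α v t)

theorem HasCaputoDeriv.caputoDeriv_eq {α : ℝ} {v : ℝ → X} {t : ℝ} {d : X}
    (h : HasCaputoDeriv α v t d) : caputoDeriv α v t = d :=
  h.2.limUnder_eq

/-- Where the usual formula `D_t^α v = J_t^{1-α} (∂_t v)` makes sense, it holds. -/
theorem hasCaputoDeriv_fracIntegral {α t : ℝ} {v : ℝ → X} (ht : 0 < t)
    (hv : ContinuousWithinAt v (Ioi 0) 0)
    (hint : IntervalIntegrable (fun s => (t - s) ^ (-α) • deriv v s) volume 0 t) :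
    HasCaputoDeriv α v t (fracIntegral (1 - α) (deriv v) t) := by
  refine ⟨fun ε hε => hint.mono_set ?_, ?_⟩
  · rw [uIcc_of_le hε.2.le, uIcc_of_le ht.le]
    exact Icc_subset_Icc_left hε.1.le
  · have h1 : Tendsto (fun ε => t ^ (-α) • (v ε - v 0)) (𝓝[>] 0) (𝓝 0) := by
      have h := (Tendsto.sub_const hv (v 0)).const_smul (t ^ (-α))
      simpa using h
    have h2 : Tendsto (fun ε => ∫ s in ε..t, (t - s) ^ (-α) • deriv v s) (𝓝[>] 0)
        (𝓝 (∫ s in (0 : ℝ)..t, (t - s) ^ (-α) • deriv v s)) := by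
      have hc := intervalIntegral.continuousOn_primitive_interval_left
        (μ := volume) (a := 0) (b := t) (f := fun s => (t - s) ^ (-α) • deriv v s)
        (by rw [uIcc_of_le ht.le]
            exact (intervalIntegrable_iff_integrableOn_Icc_of_le ht.le).1 hint)
      have h0 := hc 0 left_mem_uIcc
      rw [uIcc_of_le ht.le] at h0
      refine Tendsto.mono_left h0 ?_
      rw [← nhdsWithin_Ioo_eq_nhdsGT ht]
      exact nhdsWithin_mono _ Ioo_subset_Icc_self
    have h3 := (h1.add h2).const_smul (Real.Gamma (1 - α))⁻¹
    have e : (1 - α - 1) = -α := by ring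
    rw [fracIntegral, e]
    rw [zero_add] at h3
    exact h3

/-- `v ∈ L_∞(0, t; X) ∩ W^{1,∞}(ε, t; X)` for any `0 < ε < t ≤ T`.  Membership in `W^{1,∞}` means
that `v` is the primitive of an essentially bounded function, which is then `∂_t v`. -/
structure TimeRegular (T : ℝ) (v : ℝ → X) : Prop where
  memLp : ∀ t, 0 < t → t ≤ T → MemLp v ∞ (volume.restrict (Ioo 0 t))
  memLp_deriv : ∀ ε t, 0 < ε → ε < t → t ≤ T → MemLp (deriv v) ∞ (volume.restrict (Ioo ε t))
  integral_deriv : ∀ a b, 0 < a → a ≤ b → b ≤ T → ∫ s in a..b, deriv v s = v b - v a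

end Time

/-! ### The spaces `L₂(Ω)`, `H₀¹(Ω)` and `H⁻¹(Ω)` for `Ω ⊆ ℝᵈ` -/

section Space

variable {d : ℕ}

/-- The real Hilbert space `L₂(Ω)`. -/
abbrev L2 (Ω : Set (EuclideanSpace ℝ (Fin d))) : Type :=
  Lp ℝ 2 ((volume : Measure (EuclideanSpace ℝ (Fin d))).restrict Ω)

/-- The Hilbert space `L₂(Ω) × L₂(Ω)ᵈ` of pairs `(v, g)`, with the norm
`(‖v‖² + ∑ i, ‖g i‖²)^{1/2}`, which for `g = ∇ v` is the norm of `H¹(Ω)`. -/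
abbrev L2Pair (Ω : Set (EuclideanSpace ℝ (Fin d))) : Type :=
  WithLp 2 (L2 Ω × PiLp 2 (fun _ : Fin d => L2 Ω))

/-- The pairs `(φ, ∇ φ)` with `φ ∈ C_c^∞(Ω)`. -/
def testPairs (Ω : Set (EuclideanSpace ℝ (Fin d))) : Submodule ℝ (L2Pair Ω) where
  carrier := {w | ∃ φ : EuclideanSpace ℝ (Fin d) → ℝ,
    ContDiff ℝ ∞ φ ∧ HasCompactSupport φ ∧ tsupport φ ⊆ Ω ∧
    w.fst =ᵐ[volume.restrict Ω] φ ∧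
    ∀ i, w.snd i =ᵐ[volume.restrict Ω] fun x => fderiv ℝ φ x (EuclideanSpace.single i 1)}
  zero_mem' := by
    refine ⟨0, contDiff_const, HasCompactSupport.zero, by simp, Lp.coeFn_zero _ _ _,
      fun i => ?_⟩
    filter_upwards [Lp.coeFn_zero ℝ 2 ((volume : Measure (EuclideanSpace ℝ (Fin d))).restrict Ω)]
      with x hx
    simpa using hx
  add_mem' := by
    rintro w w' ⟨φ, h1, h2, h3, h4, h5⟩ ⟨ψ, k1, k2, k3, k4, k5⟩
    refine ⟨φ + ψ, h1.add k1, h2.add k2,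
      (tsupport_add φ ψ).trans (union_subset h3 k3), ?_, fun i => ?_⟩
    · filter_upwards [Lp.coeFn_add w.fst w'.fst, h4, k4] with x e e1 e2
      exact e.trans (congrArg₂ (· + ·) e1 e2)
    · filter_upwards [Lp.coeFn_add (w.snd i) (w'.snd i), h5 i, k5 i] with x e e1 e2
      have hd := fderiv_add (h1.differentiable (by simp) x) (k1.differentiable (by simp) x)
      rw [hd]
      exact e.trans (congrArg₂ (· + ·) e1 e2)
  smul_mem' := by
    rintro c w ⟨φ, h1, h2, h3, h4, h5⟩
    refine ⟨c • φ, h1.const_smul c, h2.smul_left (f := fun _ => c),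
      (tsupport_smul_subset_right (fun _ => c) φ).trans h3, ?_, fun i => ?_⟩
    · filter_upwards [Lp.coeFn_smul c w.fst, h4] with x e e1
      simp [e, e1]
    · filter_upwards [Lp.coeFn_smul c (w.snd i), h5 i] with x e e1
      have hd := fderiv_const_smul (h1.differentiable (by simp) x) c
      simp [hd, e, e1]

/-- The Hilbert space `H₀¹(Ω)`, the closure of `C_c^∞(Ω)` in the norm of `H¹(Ω)`; its elements
are stored as pairs `(v, ∇ v)`. -/
abbrev H01 (Ω : Set (EuclideanSpace ℝ (Fin d))) : Type :=
  (testPairs Ω).topologicalClosure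

/-- The space `H⁻¹(Ω)`, the dual of `H₀¹(Ω)`. -/
abbrev Hneg1 (Ω : Set (EuclideanSpace ℝ (Fin d))) : Type :=
  H01 Ω →L[ℝ] ℝ

/-- The embedding `H₀¹(Ω) → L₂(Ω)`, `(v, ∇ v) ↦ v`. -/
def H01.toL2 (Ω : Set (EuclideanSpace ℝ (Fin d))) : H01 Ω →L[ℝ] L2 Ω :=
  (WithLp.fstL 2 ℝ (L2 Ω) (PiLp 2 (fun _ : Fin d => L2 Ω))).comp
    (testPairs Ω).topologicalClosure.subtypeL

/-- The embedding `L₂(Ω) → H⁻¹(Ω)`, `w ↦ ⟨w, ·⟩`. -/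
def L2.toHneg1 {Ω : Set (EuclideanSpace ℝ (Fin d))} (w : L2 Ω) : Hneg1 Ω :=
  (innerSL ℝ w).comp (H01.toL2 Ω)

/-- `R` is the residual `(D_t^α + 𝓛) w - f` of `w` on `(0, T]`: for every such `t`, the function
`w(·, t)` is in `H₀¹(Ω)` and the residual `R(·, t)` is in `L₂(Ω)` (in particular, `w(·, t) = 0` on
`∂Ω`); the equation holds in `H⁻¹(Ω)`. -/
def IsResidual {Ω : Set (EuclideanSpace ℝ (Fin d))} (α T : ℝ) (L : H01 Ω →L[ℝ] Hneg1 Ω)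
    (f : ℝ → Hneg1 Ω) (w R : ℝ → L2 Ω) : Prop :=
  ∀ t ∈ Ioc 0 T, ∃ W : H01 Ω, H01.toL2 Ω W = w t ∧
    L2.toHneg1 (R t) = L2.toHneg1 (caputoDeriv α w t) + L W - f t

/-- `u` solves `D_t^α u + 𝓛 u = f` in `Ω × (0, T]`, `u = 0` on `∂Ω`, `u(·, 0) = u₀`. -/
def IsSolution {Ω : Set (EuclideanSpace ℝ (Fin d))} (α T : ℝ) (L : H01 Ω →L[ℝ] Hneg1 Ω)
    (f : ℝ → Hneg1 Ω) (u₀ : L2 Ω) (u : ℝ → L2 Ω) : Prop :=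
  u 0 = u₀ ∧ ∀ t ∈ Ioc 0 T, ∃ U : H01 Ω, H01.toL2 Ω U = u t ∧
    L2.toHneg1 (caputoDeriv α u t) + L U = f t

end Space

end

/-! Let `e = uh - u`, and count the jump at time `0` from the value `0`, which turns the Caputo
derivative into the Riemann-Liouville one, `D`. If a nonnegative function vanishes at a time
`t > 0`, its `D` at `t` is nonpositive, as one sees by integrating by parts against the increasing
kernel `(t - s) ^ (-α)`. Let `B` be a positive function that blows up at time `0` and satisfies
`(D + lam) B > 0`. If `‖e‖ ≤ E` failed, then, `e` being bounded, some multiple `δ B` with `δ > 0`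
would touch `‖e‖ - E` from above at a time `t`. For `l = ⟪e t, ·⟫ / ‖e t‖`, the function
`E + δ B - l ∘ e` is nonnegative and vanishes at `t`, whence `D E + δ D B ≤ l (D e)` there. But
testing the difference of the two equations with `e t` gives `l (D e) + lam ‖e‖ ≤ (D + lam) E`,
and the two inequalities add up to `δ (D + lam) B ≤ 0`. -/

section Kernel

variable {α t s a b : ℝ}

theorem hasDerivAt_sub_rpow_neg (hs : s < t) :
    HasDerivAt (fun s => (t - s) ^ (-α)) (α * (t - s) ^ (-α - 1)) s := by
  convert ((hasDerivAt_id' s).const_sub t).rpow_const (p := -α) (Or.inl (sub_pos.2 hs).ne') using 1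
  ring

theorem continuousOn_mul_sub_rpow_neg_sub_one :
    ContinuousOn (fun s => α * (t - s) ^ (-α - 1)) (Iio t) :=
  continuousOn_const.mul <| (continuousOn_const.sub continuousOn_id).rpow_const
    fun _ hs => Or.inl (sub_pos.2 hs).ne'

theorem monotoneOn_sub_rpow_neg (hα : 0 ≤ α) : MonotoneOn (fun s => (t - s) ^ (-α)) (Iio t) :=
  fun _ _ _ hb hab => Real.rpow_le_rpow_of_nonpos (sub_pos.2 hb) (by linarith) (by linarith)

theorem rpow_neg_le_sub_rpow_neg (hα : 0 ≤ α) (hs : s ∈ Ico 0 t) : t ^ (-α) ≤ (t - s) ^ (-α) := by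
  simpa using monotoneOn_sub_rpow_neg hα (hs.1.trans_lt hs.2 : (0 : ℝ) < t) hs.2 hs.1

theorem intervalIntegrable_sub_rpow_neg (hα : α < 1) :
    IntervalIntegrable (fun s => (t - s) ^ (-α)) volume a b := by
  simpa using (intervalIntegral.intervalIntegrable_rpow' (r := -α) (a := t - a) (b := t - b)
    (by linarith)).comp_sub_left t

theorem integral_sub_rpow_neg (hα : α < 1) :
    ∫ s in a..t, (t - s) ^ (-α) = (t - a) ^ (1 - α) / (1 - α) := by
  rw [intervalIntegral.integral_comp_sub_left (fun s : ℝ => s ^ (-α)),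
    integral_rpow (Or.inl (by linarith)), sub_self, Real.zero_rpow (by linarith), sub_zero,
    neg_add_eq_sub]

end Kernel

section Density

variable {X Y : Type*} [NormedAddCommGroup X] [NormedSpace ℝ X] [NormedAddCommGroup Y]
  [NormedSpace ℝ Y] {v w q r : ℝ → X} {a b : ℝ}

/-- `v` is absolutely continuous on `[a, b]` with density `q`: it is a primitive of the integrable
function `q`. -/
structure HasDensityOn (v q : ℝ → X) (a b : ℝ) : Prop where
  intervalIntegrable : IntervalIntegrable q volume a b
  integral_eq : ∀ x ∈ Icc a b, ∫ s in a..x, q s = v x - v a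

theorem intervalIntegrable_clm_comp (l : X →L[ℝ] Y) (hq : IntervalIntegrable q volume a b) :
    IntervalIntegrable (fun s => l (q s)) volume a b :=
  ⟨l.integrable_comp hq.1, l.integrable_comp hq.2⟩

theorem continuousOn_integral_left {c : ℝ} (hq : IntervalIntegrable q volume a b)
    (hc : c ∈ uIcc a b) : ContinuousOn (fun x => ∫ s in x..c, q s) (uIcc a b) :=
  (intervalIntegral.continuousOn_primitive_interval' hq hc).neg.congr fun _ _ =>
    intervalIntegral.integral_symm _ _

namespace HasDensityOn

theorem intervalIntegrable_of_mem (h : HasDensityOn v q a b) {c d : ℝ} (hc : c ∈ Icc a b)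
    (hd : d ∈ Icc a b) : IntervalIntegrable q volume c d :=
  h.intervalIntegrable.mono_set <| by
    rw [uIcc_of_le (hc.1.trans hc.2)]
    exact ordConnected_Icc.uIcc_subset hc hd

theorem integral_eq_sub (h : HasDensityOn v q a b) {c d : ℝ} (hc : c ∈ Icc a b)
    (hd : d ∈ Icc a b) : ∫ s in c..d, q s = v d - v c := by
  have ha : a ∈ Icc a b := left_mem_Icc.2 (hc.1.trans hc.2)
  rw [← intervalIntegral.integral_interval_sub_left (h.intervalIntegrable_of_mem ha hd)
    (h.intervalIntegrable_of_mem ha hc), h.integral_eq d hd, h.integral_eq c hc,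
    sub_sub_sub_cancel_right]

theorem mono (h : HasDensityOn v q a b) {c d : ℝ} (hc : c ∈ Icc a b) (hd : d ∈ Icc a b) :
    HasDensityOn v q c d :=
  ⟨h.intervalIntegrable_of_mem hc hd, fun _ hx =>
    h.integral_eq_sub hc ⟨hc.1.trans hx.1, hx.2.trans hd.2⟩⟩

theorem add (hv : HasDensityOn v q a b) (hw : HasDensityOn w r a b) :
    HasDensityOn (v + w) (q + r) a b where
  intervalIntegrable := hv.intervalIntegrable.add hw.intervalIntegrable
  integral_eq x hx := by
    have ha : a ∈ Icc a b := left_mem_Icc.2 (hx.1.trans hx.2)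
    simp only [Pi.add_apply]
    rw [intervalIntegral.integral_add (hv.intervalIntegrable_of_mem ha hx)
      (hw.intervalIntegrable_of_mem ha hx), hv.integral_eq x hx, hw.integral_eq x hx,
      add_sub_add_comm]

theorem neg (hv : HasDensityOn v q a b) : HasDensityOn (-v) (-q) a b where
  intervalIntegrable := hv.intervalIntegrable.neg
  integral_eq x hx := by
    simp only [Pi.neg_apply, intervalIntegral.integral_neg, hv.integral_eq x hx]
    abel

theorem clm_comp [CompleteSpace X] [CompleteSpace Y] (hv : HasDensityOn v q a b) (l : X →L[ℝ] Y) :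
    HasDensityOn (fun s => l (v s)) (fun s => l (q s)) a b where
  intervalIntegrable := intervalIntegrable_clm_comp l hv.intervalIntegrable
  integral_eq x hx := by
    rw [l.intervalIntegral_comp_comm
      (hv.intervalIntegrable_of_mem (left_mem_Icc.2 (hx.1.trans hx.2)) hx), hv.integral_eq x hx,
      map_sub]

theorem continuousOn (h : HasDensityOn v q a b) : ContinuousOn v (Icc a b) := by
  rcases lt_or_ge b a with hab | hab
  · simp [Icc_eq_empty_of_lt hab]
  rw [← uIcc_of_le hab]
  refine ((intervalIntegral.continuousOn_primitive_interval' h.intervalIntegrable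
    left_mem_uIcc).add_const (v a)).congr fun x hx => ?_
  rw [uIcc_of_le hab] at hx
  simp only [h.integral_eq x hx, sub_add_cancel]

theorem of_hasDerivAt [CompleteSpace X] (hab : a ≤ b) (hv : ∀ x ∈ Icc a b, HasDerivAt v (q x) x)
    (hq : ContinuousOn q (Icc a b)) : HasDensityOn v q a b where
  intervalIntegrable := hq.intervalIntegrable_of_Icc hab
  integral_eq x hx := by
    have hsub : Icc a x ⊆ Icc a b := Icc_subset_Icc_right hx.2
    exact intervalIntegral.integral_eq_sub_of_hasDerivAt
      (fun s hs => hv s (hsub (uIcc_of_le hx.1 ▸ hs)))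
      ((hq.mono hsub).intervalIntegrable_of_Icc hx.1)

theorem of_absolutelyContinuousOnInterval {z : ℝ → ℝ}
    (hz : AbsolutelyContinuousOnInterval z a b) : HasDensityOn z (deriv z) a b where
  intervalIntegrable := hz.intervalIntegrable_deriv
  integral_eq x hx := (hz.mono (by
    rw [uIcc_of_le hx.1, uIcc_of_le (hx.1.trans hx.2)]
    exact Icc_subset_Icc_right hx.2)).integral_deriv_eq_sub

theorem integral_mul {z p φ ψ : ℝ → ℝ} (hφ : HasDensityOn φ ψ a b) (hz : HasDensityOn z p a b)
    (hab : a ≤ b) :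
    ∫ s in a..b, φ s * p s = φ b * z b - φ a * z a - ∫ s in a..b, ψ s * z s := by
  have primitive_ac {z p : ℝ → ℝ} (hz : HasDensityOn z p a b) :
      AbsolutelyContinuousOnInterval (fun x => (∫ s in a..x, p s) + z a) a b :=
    (hz.intervalIntegrable.absolutelyContinuousOnInterval_intervalIntegral left_mem_uIcc).fun_add
      (LipschitzWith.const (z a)).lipschitzOnWith.absolutelyContinuousOnInterval
  have primitive_eq {z p : ℝ → ℝ} (hz : HasDensityOn z p a b) {x : ℝ} (hx : x ∈ Icc a b) :
      (∫ s in a..x, p s) + z a = z x := by rw [hz.integral_eq x hx, sub_add_cancel]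
  have primitive_deriv {z p : ℝ → ℝ} (hz : HasDensityOn z p a b) :
      ∀ᵐ x, x ∈ uIoc a b → deriv (fun x => (∫ s in a..x, p s) + z a) x = p x := by
    filter_upwards [hz.intervalIntegrable.ae_hasDerivAt_integral] with x hx hxm
    exact ((hx (uIoc_subset_uIcc hxm) a left_mem_uIcc).add_const (z a)).deriv
  have mem {x : ℝ} (hx : x ∈ uIoc a b) : x ∈ Icc a b :=
    Ioc_subset_Icc_self (uIoc_of_le hab ▸ hx)
  have by_parts := (primitive_ac hφ).integral_mul_deriv_eq_deriv_mul (primitive_ac hz)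
  rw [primitive_eq hφ (left_mem_Icc.2 hab), primitive_eq hφ (right_mem_Icc.2 hab),
    primitive_eq hz (left_mem_Icc.2 hab), primitive_eq hz (right_mem_Icc.2 hab)] at by_parts
  convert by_parts using 1
  · refine intervalIntegral.integral_congr_ae ?_
    filter_upwards [primitive_deriv hz] with x hx hxm
    rw [hx hxm, primitive_eq hφ (mem hxm)]
  · congr 1
    refine intervalIntegral.integral_congr_ae ?_
    filter_upwards [primitive_deriv hφ] with x hx hxm
    rw [hx hxm, primitive_eq hz (mem hxm)]

theorem integral_smul [CompleteSpace X] {φ ψ : ℝ → ℝ} (hφ : HasDensityOn φ ψ a b)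
    (hv : HasDensityOn v q a b) (hab : a ≤ b) :
    ∫ s in a..b, φ s • q s = φ b • v b - φ a • v a - ∫ s in a..b, ψ s • v s := by
  refine (SeparatingDual.eq_iff_forall_dual_eq (R := ℝ)).2 fun l => ?_
  have hφq : IntervalIntegrable (fun s => φ s • q s) volume a b :=
    hv.intervalIntegrable.continuousOn_smul (uIcc_of_le hab ▸ hφ.continuousOn)
  have hψv : IntervalIntegrable (fun s => ψ s • v s) volume a b :=
    hφ.intervalIntegrable.smul_continuousOn (uIcc_of_le hab ▸ hv.continuousOn)
  simpa only [map_sub, map_smul, smul_eq_mul, ← l.intervalIntegral_comp_comm hφq,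
    ← l.intervalIntegral_comp_comm hψv] using hφ.integral_mul (hv.clm_comp l) hab

end HasDensityOn

end Density

section RiemannLiouville

variable {X Y : Type*} [NormedAddCommGroup X] [NormedSpace ℝ X] [NormedAddCommGroup Y]
  [NormedSpace ℝ Y] {α T t ε : ℝ} {v w q r : ℝ → X}

/-- `v` is locally absolutely continuous on `(0, T]` with density `q`, and the integrals over
`[ε, t]` in the fractional derivatives of order `α` of `v` converge absolutely at their singular
endpoint `t`. -/
structure HasLocalDensity (α T : ℝ) (v q : ℝ → X) : Prop where
  hasDensityOn : ∀ a ∈ Ioc 0 T, HasDensityOn v q a T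
  intervalIntegrable : ∀ t ∈ Ioc 0 T, ∀ ε ∈ Ioo 0 t,
    IntervalIntegrable (fun s => (t - s) ^ (-α) • q s) volume ε t

/-- The Riemann-Liouville derivative of order `α` at time `t` of a function `v` with density `q`,
before passing to the limit `ε → 0`: `v` is started at time `ε` from the value `0`, so that its
derivative consists of a mass `v ε`, which is moved to time `0`, and of `q` on `[ε, t]`. -/
noncomputable def rlTrunc (α : ℝ) (v q : ℝ → X) (t ε : ℝ) : X :=
  (Real.Gamma (1 - α))⁻¹ • (t ^ (-α) • v ε + ∫ s in ε..t, (t - s) ^ (-α) • q s)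

theorem caputoTrunc_eq_rlTrunc_sub :
    caputoTrunc α v t ε
      = rlTrunc α v (deriv v) t ε - ((Real.Gamma (1 - α))⁻¹ * t ^ (-α)) • v 0 := by
  rw [caputoTrunc, rlTrunc]
  module

theorem tendsto_rlTrunc_of_caputoTrunc {d : X} (h : Tendsto (caputoTrunc α v t) (𝓝[>] 0) (𝓝 d)) :
    Tendsto (rlTrunc α v (deriv v) t) (𝓝[>] 0)
      (𝓝 (d + ((Real.Gamma (1 - α))⁻¹ * t ^ (-α)) • v 0)) :=
  (h.add_const _).congr fun _ => by rw [caputoTrunc_eq_rlTrunc_sub, sub_add_cancel]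

theorem rlTrunc_neg : rlTrunc α (-v) (-q) t ε = -rlTrunc α v q t ε := by
  simp only [rlTrunc, Pi.neg_apply, smul_neg, intervalIntegral.integral_neg]
  module

theorem inv_gamma_one_sub_pos (hα : α < 1) : 0 < (Real.Gamma (1 - α))⁻¹ :=
  inv_pos.2 (Real.Gamma_pos_of_pos (sub_pos.2 hα))

namespace HasLocalDensity

theorem hasDensityOn_of_le (h : HasLocalDensity α T v q) {a b : ℝ} (ha : 0 < a) (hab : a ≤ b)
    (hb : b ≤ T) : HasDensityOn v q a b :=
  (h.hasDensityOn a ⟨ha, hab.trans hb⟩).mono ⟨le_rfl, hab.trans hb⟩ ⟨hab, hb⟩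

theorem continuousOn (h : HasLocalDensity α T v q) : ContinuousOn v (Ioc 0 T) := by
  intro t ht
  have hlt : t / 2 < t := half_lt_self ht.1
  refine ((h.hasDensityOn (t / 2) ⟨half_pos ht.1, hlt.le.trans ht.2⟩).continuousOn t
    ⟨hlt.le, ht.2⟩).mono_of_mem_nhdsWithin ?_
  filter_upwards [self_mem_nhdsWithin, mem_nhdsWithin_of_mem_nhds (Ioi_mem_nhds hlt)] with s hs hs'
  exact ⟨le_of_lt hs', hs.2⟩

theorem add (hv : HasLocalDensity α T v q) (hw : HasLocalDensity α T w r) :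
    HasLocalDensity α T (v + w) (q + r) where
  hasDensityOn a ha := (hv.hasDensityOn a ha).add (hw.hasDensityOn a ha)
  intervalIntegrable t ht ε hε := by
    simpa only [Pi.add_apply, smul_add] using
      (hv.intervalIntegrable t ht ε hε).add (hw.intervalIntegrable t ht ε hε)

theorem rlTrunc_add (hv : HasLocalDensity α T v q) (hw : HasLocalDensity α T w r)
    (ht : t ∈ Ioc 0 T) (hε : ε ∈ Ioo 0 t) :
    rlTrunc α (v + w) (q + r) t ε = rlTrunc α v q t ε + rlTrunc α w r t ε := by
  simp only [rlTrunc, Pi.add_apply, smul_add]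
  rw [intervalIntegral.integral_add (hv.intervalIntegrable t ht ε hε)
    (hw.intervalIntegrable t ht ε hε)]
  module

theorem neg (hv : HasLocalDensity α T v q) : HasLocalDensity α T (-v) (-q) where
  hasDensityOn a ha := (hv.hasDensityOn a ha).neg
  intervalIntegrable t ht ε hε := by
    simp only [Pi.neg_apply, smul_neg]
    exact (hv.intervalIntegrable t ht ε hε).neg

theorem sub (hv : HasLocalDensity α T v q) (hw : HasLocalDensity α T w r) :
    HasLocalDensity α T (v - w) (q - r) := by
  simpa only [sub_eq_add_neg] using hv.add hw.neg

theorem rlTrunc_sub (hv : HasLocalDensity α T v q) (hw : HasLocalDensity α T w r)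
    (ht : t ∈ Ioc 0 T) (hε : ε ∈ Ioo 0 t) :
    rlTrunc α (v - w) (q - r) t ε = rlTrunc α v q t ε - rlTrunc α w r t ε := by
  simp only [sub_eq_add_neg, hv.rlTrunc_add hw.neg ht hε, rlTrunc_neg]

variable [CompleteSpace X]

theorem of_hasDerivAt (hα : α < 1) (hv : ∀ s ∈ Ioc 0 T, HasDerivAt v (q s) s)
    (hq : ContinuousOn q (Ioc 0 T)) : HasLocalDensity α T v q where
  hasDensityOn a ha := .of_hasDerivAt ha.2 (fun s hs => hv s ⟨ha.1.trans_le hs.1, hs.2⟩)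
    (hq.mono fun _ hs => ⟨ha.1.trans_le hs.1, hs.2⟩)
  intervalIntegrable t ht ε hε := by
    refine (intervalIntegrable_sub_rpow_neg hα).smul_continuousOn (hq.mono fun s hs => ?_)
    rw [uIcc_of_le hε.2.le] at hs
    exact ⟨hε.1.trans_le hs.1, hs.2.trans ht.2⟩

variable [CompleteSpace Y]

theorem clm_comp (hv : HasLocalDensity α T v q) (l : X →L[ℝ] Y) :
    HasLocalDensity α T (fun s => l (v s)) (fun s => l (q s)) where
  hasDensityOn a ha := (hv.hasDensityOn a ha).clm_comp l
  intervalIntegrable t ht ε hε := by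
    simpa only [map_smul] using intervalIntegrable_clm_comp l (hv.intervalIntegrable t ht ε hε)

theorem rlTrunc_clm_comp (hv : HasLocalDensity α T v q) (l : X →L[ℝ] Y) (ht : t ∈ Ioc 0 T)
    (hε : ε ∈ Ioo 0 t) :
    rlTrunc α (fun s => l (v s)) (fun s => l (q s)) t ε = l (rlTrunc α v q t ε) := by
  simp only [rlTrunc, map_smul, map_add,
    ← l.intervalIntegral_comp_comm (hv.intervalIntegrable t ht ε hε)]

end HasLocalDensity

end RiemannLiouville

section Touching

variable {α T t ε : ℝ} {z q : ℝ → ℝ}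

theorem hasDensityOn_sub_rpow_neg {a b : ℝ} (hab : a ≤ b) (hb : b < t) :
    HasDensityOn (fun s => (t - s) ^ (-α)) (fun s => α * (t - s) ^ (-α - 1)) a b :=
  .of_hasDerivAt hab (fun _ hs => hasDerivAt_sub_rpow_neg (hs.2.trans_lt hb))
    (continuousOn_mul_sub_rpow_neg_sub_one.mono fun _ hs => hs.2.trans_lt hb)

theorem integral_sub_rpow_neg_mul_le_of_touching {a r : ℝ} (hα : 0 ≤ α) (har : a ≤ r) (hrt : r < t)
    (hz : HasDensityOn z q a t)
    (hq : IntervalIntegrable (fun s => (t - s) ^ (-α) * q s) volume r t)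
    (hnonneg : ∀ s ∈ Icc a t, 0 ≤ z s) (hzero : z t = 0) :
    ∫ s in a..r, (t - s) ^ (-α) * q s
      ≤ (∫ s in r..t, |(t - s) ^ (-α) * q s|) - (t - a) ^ (-α) * z a := by
  have hr : r ∈ Icc a t := ⟨har, hrt.le⟩
  -- The kernel is singular at `t`, so the integration by parts stops at `r`; the boundary term at
  -- `r` is `-(t - r) ^ (-α) * ∫ s in r..t, q s`, and `(t - r) ^ (-α)` is the minimum of the kernel.
  have by_parts := (hasDensityOn_sub_rpow_neg (α := α) har hrt).integral_mul
    (hz.mono (left_mem_Icc.2 (har.trans hrt.le)) hr) har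
  have integral_nonneg : 0 ≤ ∫ s in a..r, α * (t - s) ^ (-α - 1) * z s :=
    intervalIntegral.integral_nonneg har fun s hs => mul_nonneg
      (mul_nonneg hα (Real.rpow_nonneg (sub_nonneg.2 (hs.2.trans hrt.le)) _))
      (hnonneg s ⟨hs.1, hs.2.trans hrt.le⟩)
  have boundary_le : (t - r) ^ (-α) * z r ≤ ∫ s in r..t, |(t - s) ^ (-α) * q s| := by
    have ht : t ∈ Icc a t := right_mem_Icc.2 (har.trans hrt.le)
    have hzr : z r = ∫ s in r..t, -q s := by
      rw [intervalIntegral.integral_neg, hz.integral_eq_sub hr ht, hzero, zero_sub, neg_neg]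
    rw [hzr, ← intervalIntegral.integral_const_mul]
    refine intervalIntegral.integral_mono_on_of_le_Ioo hrt.le
      ((hz.intervalIntegrable_of_mem hr ht).neg.const_mul _) hq.abs fun s hs => ?_
    have hk : 0 ≤ (t - r) ^ (-α) := Real.rpow_nonneg (sub_nonneg.2 hrt.le) _
    have hks : (t - r) ^ (-α) ≤ (t - s) ^ (-α) := monotoneOn_sub_rpow_neg hα hrt hs.2 hs.1.le
    calc (t - r) ^ (-α) * -q s ≤ (t - r) ^ (-α) * |q s| := by gcongr; exact neg_le_abs _
      _ ≤ (t - s) ^ (-α) * |q s| := by gcongr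
      _ = |(t - s) ^ (-α) * q s| := by rw [abs_mul, abs_of_nonneg (hk.trans hks)]
  linarith

theorem integral_sub_rpow_neg_mul_le_neg {a : ℝ} (hα : 0 ≤ α) (hat : a < t)
    (hz : HasDensityOn z q a t)
    (hq : IntervalIntegrable (fun s => (t - s) ^ (-α) * q s) volume a t)
    (hnonneg : ∀ s ∈ Icc a t, 0 ≤ z s) (hzero : z t = 0) :
    ∫ s in a..t, (t - s) ^ (-α) * q s ≤ -((t - a) ^ (-α) * z a) := by
  have le_nhds : 𝓝[<] t ≤ 𝓝[uIcc a t] t :=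
    nhdsWithin_le_of_mem (uIcc_of_le hat.le ▸ Icc_mem_nhdsLT hat)
  have head : Tendsto (fun r => ∫ s in a..r, (t - s) ^ (-α) * q s) (𝓝[<] t)
      (𝓝 (∫ s in a..t, (t - s) ^ (-α) * q s)) :=
    (intervalIntegral.continuousOn_primitive_interval' hq left_mem_uIcc t right_mem_uIcc).mono_left
      le_nhds
  have tail : Tendsto (fun r => ∫ s in r..t, |(t - s) ^ (-α) * q s|) (𝓝[<] t) (𝓝 0) := by
    simpa only [intervalIntegral.integral_same] using
      (continuousOn_integral_left hq.abs right_mem_uIcc t right_mem_uIcc).tendsto.mono_left le_nhds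
  rw [← zero_sub (_ * _)]
  refine le_of_tendsto_of_tendsto head (tail.sub_const _) ?_
  filter_upwards [Ioo_mem_nhdsLT hat] with r hr
  refine integral_sub_rpow_neg_mul_le_of_touching hα hr.1.le hr.2 hz (hq.mono_set ?_) hnonneg hzero
  rw [uIcc_of_le hr.2.le, uIcc_of_le hat.le]
  exact Icc_subset_Icc_left hr.1.le

theorem HasLocalDensity.rlTrunc_nonpos_of_touching (hα : α ∈ Ico 0 1)
    (hz : HasLocalDensity α T z q) (ht : t ≤ T) (hε : ε ∈ Ioo 0 t)
    (hnonneg : ∀ s ∈ Ioc 0 t, 0 ≤ z s) (hzero : z t = 0) : rlTrunc α z q t ε ≤ 0 := by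
  have hpos : ∀ s ∈ Icc ε t, 0 ≤ z s := fun s hs => hnonneg s ⟨hε.1.trans_le hs.1, hs.2⟩
  have hint := integral_sub_rpow_neg_mul_le_neg hα.1 hε.2
    (hz.hasDensityOn_of_le hε.1 hε.2.le ht) (hz.intervalIntegrable t ⟨hε.1.trans hε.2, ht⟩ ε hε)
    hpos hzero
  have hle : t ^ (-α) * z ε ≤ (t - ε) ^ (-α) * z ε :=
    mul_le_mul_of_nonneg_right (rpow_neg_le_sub_rpow_neg hα.1 ⟨hε.1.le, hε.2⟩)
      (hpos ε (left_mem_Icc.2 hε.2.le))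
  refine mul_nonpos_of_nonneg_of_nonpos (inv_gamma_one_sub_pos hα.2).le ?_
  simp only [smul_eq_mul]
  linarith

end Touching

section Existence

variable {X : Type*} [NormedAddCommGroup X] [NormedSpace ℝ X] [CompleteSpace X] {α T t : ℝ}
  {v q : ℝ → X}

namespace HasLocalDensity

theorem rlTrunc_eq_by_parts (hv : HasLocalDensity α T v q) (ht : t ∈ Ioc 0 T) {ε b : ℝ}
    (hε : 0 < ε) (hεb : ε ≤ b) (hbt : b < t) :
    rlTrunc α v q t ε = (Real.Gamma (1 - α))⁻¹ • ((t ^ (-α) - (t - ε) ^ (-α)) • v ε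
      + ((t - b) ^ (-α) • v b + ∫ s in b..t, (t - s) ^ (-α) • q s)
      - ∫ s in ε..b, (α * (t - s) ^ (-α - 1)) • v s) := by
  have hq := hv.intervalIntegrable t ht ε ⟨hε, hεb.trans_lt hbt⟩
  have mem : b ∈ uIcc ε t := uIcc_of_le (hεb.trans hbt.le) ▸ ⟨hεb, hbt.le⟩
  have split := intervalIntegral.integral_add_adjacent_intervals
    (hq.mono_set (uIcc_subset_uIcc left_mem_uIcc mem))
    (hq.mono_set (uIcc_subset_uIcc mem right_mem_uIcc))
  rw [(hasDensityOn_sub_rpow_neg hεb hbt).integral_smul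
    (hv.hasDensityOn_of_le hε hεb (hbt.le.trans ht.2)) hεb] at split
  rw [rlTrunc, ← split]
  module

theorem exists_tendsto_rlTrunc {M : ℝ} (hv : HasLocalDensity α T v q)
    (hM : ∀ s ∈ Ioc 0 T, ‖v s‖ ≤ M) (ht : t ∈ Ioc 0 T) :
    ∃ d, Tendsto (rlTrunc α v q t) (𝓝[>] 0) (𝓝 d) := by
  obtain ⟨b, hb0, hbt⟩ := exists_between ht.1
  have hsub : Ioc 0 b ⊆ Ioc 0 T := Ioc_subset_Ioc_right (hbt.le.trans ht.2)
  have kernel : ContinuousAt (fun ε => t ^ (-α) - (t - ε) ^ (-α)) 0 :=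
    continuousAt_const.sub (hasDerivAt_sub_rpow_neg ht.1).continuousAt
  have jump : Tendsto (fun ε => (t ^ (-α) - (t - ε) ^ (-α)) • v ε) (𝓝[>] 0) (𝓝 0) := by
    refine Tendsto.zero_smul_isBoundedUnder_le ?_ (isBoundedUnder_of_eventually_le (a := M) ?_)
    · simpa using kernel.tendsto.mono_left nhdsWithin_le_nhds
    · filter_upwards [Ioo_mem_nhdsGT ht.1] with s hs using hM s ⟨hs.1, hs.2.le.trans ht.2⟩
  have integrable_v : IntegrableOn v (Ioc 0 b) :=
    .of_bound measure_Ioc_lt_top ((hv.continuousOn.mono hsub).aestronglyMeasurable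
      measurableSet_Ioc) M ((ae_restrict_iff' measurableSet_Ioc).2 (.of_forall fun s hs =>
        hM s (hsub hs)))
  have integrable : IntervalIntegrable (fun s => (α * (t - s) ^ (-α - 1)) • v s) volume 0 b :=
    ((intervalIntegrable_iff_integrableOn_Ioc_of_le hb0.le).2 integrable_v).continuousOn_smul
      (continuousOn_mul_sub_rpow_neg_sub_one.mono fun s hs => by
        rw [uIcc_of_le hb0.le] at hs
        exact hs.2.trans_lt hbt)
  have tail : Tendsto (fun ε => ∫ s in ε..b, (α * (t - s) ^ (-α - 1)) • v s) (𝓝[>] 0)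
      (𝓝 (∫ s in (0 : ℝ)..b, (α * (t - s) ^ (-α - 1)) • v s)) :=
    (continuousOn_integral_left integrable right_mem_uIcc 0 left_mem_uIcc).mono_left
      (nhdsWithin_le_of_mem (uIcc_of_le hb0.le ▸ Icc_mem_nhdsGT hb0))
  refine ⟨_, (((jump.add_const ((t - b) ^ (-α) • v b + ∫ s in b..t, (t - s) ^ (-α) • q s)).sub
    tail).const_smul (Real.Gamma (1 - α))⁻¹).congr' ?_⟩
  filter_upwards [Ioo_mem_nhdsGT hb0] with ε hε
  exact (hv.rlTrunc_eq_by_parts ht hε.1 hε.2.le hbt).symm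

end HasLocalDensity

end Existence

namespace TimeRegular

variable {X : Type*} [NormedAddCommGroup X] [NormedSpace ℝ X] {α T t : ℝ} {v : ℝ → X}

theorem hasLocalDensity (hv : TimeRegular T v) (hα : α < 1) :
    HasLocalDensity α T v (deriv v) := by
  have memLp {a b : ℝ} (ha : 0 < a) (hab : a ≤ b) (hb : b ≤ T) :
      MemLp (deriv v) ∞ (volume.restrict (Ioc a b)) := by
    rcases hab.eq_or_lt with rfl | hab
    · simp
    · rw [← restrict_Ioo_eq_restrict_Ioc]
      exact hv.memLp_deriv a b ha hab hb
  refine ⟨fun a ha => ⟨?_, fun x hx => hv.integral_deriv a x ha.1 hx.1 hx.2⟩,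
    fun t ht ε hε => ?_⟩
  · rw [intervalIntegrable_iff_integrableOn_Ioc_of_le ha.2]
    exact (memLp ha.1 ha.2 le_rfl).integrable le_top
  · have hk : IntervalIntegrable (fun s => (t - s) ^ (-α)) volume ε t :=
      intervalIntegrable_sub_rpow_neg hα
    rw [intervalIntegrable_iff_integrableOn_Ioc_of_le hε.2.le] at hk ⊢
    exact memLp_one_iff_integrable.1
      ((memLp hε.1 hε.2.le ht.2).smul (memLp_one_iff_integrable.2 hk))

theorem exists_norm_le (hv : TimeRegular T v) : ∃ M, ∀ t ∈ Ioc 0 T, ‖v t‖ ≤ M := by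
  rcases le_or_gt T 0 with hT | hT
  · exact ⟨0, fun t ht => absurd (ht.1.trans_le ht.2) hT.not_gt⟩
  have hmem := hv.memLp T hT le_rfl
  refine ⟨lpNorm v ∞ (volume.restrict (Ioo 0 T)), fun t ht => ?_⟩
  have cont : ContinuousOn v (Ioc 0 T) := (hv.hasLocalDensity zero_lt_one).continuousOn
  have ae_le : ∀ᵐ s ∂volume.restrict (Ioc 0 T), ‖v s‖ ≤ lpNorm v ∞ (volume.restrict (Ioo 0 T)) := by
    rw [← restrict_Ioo_eq_restrict_Ioc]
    exact ae_le_lpNorm_exponent_top hmem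
  exact max_eq_right_iff.1 (Measure.eqOn_Ioc_of_ae_eq volume
    (ae_le.mono fun s hs => max_eq_right hs) (cont.norm.sup continuousOn_const)
    continuousOn_const ht)

variable [CompleteSpace X]

theorem tendsto_caputoTrunc (hv : TimeRegular T v) (hα : α < 1) (ht : t ∈ Ioc 0 T) :
    Tendsto (caputoTrunc α v t) (𝓝[>] 0) (𝓝 (caputoDeriv α v t)) := by
  obtain ⟨M, hM⟩ := hv.exists_norm_le
  obtain ⟨d, hd⟩ := (hv.hasLocalDensity hα).exists_tendsto_rlTrunc hM ht
  exact tendsto_nhds_limUnder ⟨_, (hd.sub_const (((Real.Gamma (1 - α))⁻¹ * t ^ (-α)) • v 0)).congr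
    fun ε => caputoTrunc_eq_rlTrunc_sub.symm⟩

end TimeRegular

section Barrier

variable {α t ε : ℝ}

/-- `B` is a barrier at time `0` for the operator `D^α + lam`, where `D^α` is the Riemann-Liouville
derivative and `B'` the density of `B`: a positive strict supersolution that blows up at time `0`.
The bound is on the truncated derivative, so that the derivative itself need not exist. -/
structure IsBarrier (α lam T : ℝ) (B B' : ℝ → ℝ) : Prop where
  hasLocalDensity : HasLocalDensity α T B B'
  pos : ∀ t ∈ Ioc 0 T, 0 < B t
  tendsto_atTop : Tendsto B (𝓝[>] 0) atTop
  supersolution : ∀ t ∈ Ioc 0 T, ∃ c > 0, ∀ᶠ ε in 𝓝[>] 0, c ≤ rlTrunc α B B' t ε + lam * B t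

theorem mul_one_add_sub_le_rpow_neg {μ x : ℝ} (hα : 0 ≤ α) (hμ : 0 < μ) (hx : 0 < x) :
    μ ^ α * (1 + α - α * μ * x) ≤ x ^ (-α) := by
  have hy : 0 < μ * x := mul_pos hμ hx
  have tangent : 1 + α - α * μ * x ≤ (μ * x) ^ (-α) :=
    calc 1 + α - α * μ * x = -α * (μ * x - 1) + 1 := by ring
      _ ≤ -α * Real.log (μ * x) + 1 := by
        linarith [mul_le_mul_of_nonneg_left (Real.log_le_sub_one_of_pos hy) hα]
      _ ≤ Real.exp (-α * Real.log (μ * x)) := Real.add_one_le_exp _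
      _ = (μ * x) ^ (-α) := by rw [Real.rpow_def_of_pos hy, mul_comm]
  calc μ ^ α * (1 + α - α * μ * x) ≤ μ ^ α * (μ * x) ^ (-α) := by gcongr
    _ = x ^ (-α) := by
      rw [Real.mul_rpow hμ.le hx.le, ← mul_assoc, ← Real.rpow_add hμ, add_neg_cancel,
        Real.rpow_zero, one_mul]

theorem rpow_mul_exp_le_rlTrunc_exp {μ : ℝ} (hα : α ∈ Ico 0 1) (hμ : 0 < μ) (hε : ε ∈ Ioo 0 t)
    (hμε : μ * ε ≤ 1) :
    (Real.Gamma (1 - α))⁻¹ * (μ ^ α * Real.exp (μ * t))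
      ≤ rlTrunc α (fun s => Real.exp (μ * s)) (fun s => μ * Real.exp (μ * s)) t ε := by
  have cont : Continuous fun s => μ * Real.exp (μ * s) := by fun_prop
  have primitive : ∀ s, HasDerivAt (fun s => μ ^ α * (1 - α * μ * (t - s)) * Real.exp (μ * s))
      (μ ^ α * (1 + α - α * μ * (t - s)) * (μ * Real.exp (μ * s))) s := fun s => by
    refine ((((((hasDerivAt_id' s).const_sub t).const_mul (α * μ)).const_sub 1).const_mul
      (μ ^ α)).mul ((hasDerivAt_id' s).const_mul μ).exp).congr_deriv ?_
    ring
  -- With the kernel replaced by its tangent at distance `μ⁻¹` from `t`, the integral is elementary.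
  have integral_le : ∫ s in ε..t, μ ^ α * (1 + α - α * μ * (t - s)) * (μ * Real.exp (μ * s))
      ≤ ∫ s in ε..t, (t - s) ^ (-α) * (μ * Real.exp (μ * s)) :=
    intervalIntegral.integral_mono_on_of_le_Ioo hε.2.le
      (Continuous.intervalIntegrable (by fun_prop) _ _)
      ((intervalIntegrable_sub_rpow_neg hα.2).mul_continuousOn cont.continuousOn) fun s hs =>
        mul_le_mul_of_nonneg_right
          (mul_one_add_sub_le_rpow_neg hα.1 hμ (sub_pos.2 hs.2)) (by positivity)
  rw [intervalIntegral.integral_eq_sub_of_hasDerivAt (fun s _ => primitive s)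
    (Continuous.intervalIntegrable (by fun_prop) _ _)] at integral_le
  have jump_le : μ ^ α * (1 + α - α * μ * t) * Real.exp (μ * ε) ≤ t ^ (-α) * Real.exp (μ * ε) :=
    mul_le_mul_of_nonneg_right (mul_one_add_sub_le_rpow_neg hα.1 hμ (hε.1.trans hε.2))
      (Real.exp_pos _).le
  have gain : 0 ≤ μ ^ α * (α * (1 - μ * ε)) * Real.exp (μ * ε) :=
    mul_nonneg (mul_nonneg (Real.rpow_nonneg hμ.le _)
      (mul_nonneg hα.1 (sub_nonneg.2 hμε))) (Real.exp_pos _).le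
  refine mul_le_mul_of_nonneg_left ?_ (inv_gamma_one_sub_pos hα.2).le
  simp only [smul_eq_mul]
  linarith

theorem sub_rpow_neg_mul_inv_le {s : ℝ} (hα : α ≤ 1) (hs : s ∈ Ioo 0 t) :
    (t - s) ^ (-α) * s⁻¹ ≤ t ^ (-α) * s⁻¹ + t⁻¹ * (t - s) ^ (-α) := by
  have hts : 0 < t - s := sub_pos.2 hs.2
  have ht : 0 < t := hs.1.trans hs.2
  have key : (t - s) ^ (-α) * (t - s) ≤ t ^ (-α) * t := by
    rw [← Real.rpow_add_one hts.ne', ← Real.rpow_add_one ht.ne']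
    exact Real.rpow_le_rpow hts.le (by linarith [hs.1]) (by linarith)
  have hst : 0 < s * t := mul_pos hs.1 ht
  calc (t - s) ^ (-α) * s⁻¹ = ((t - s) ^ (-α) * (t - s) + (t - s) ^ (-α) * s) / (s * t) := by
        field_simp [hs.1.ne']
        ring
    _ ≤ (t ^ (-α) * t + (t - s) ^ (-α) * s) / (s * t) := by gcongr
    _ = t ^ (-α) * s⁻¹ + t⁻¹ * (t - s) ^ (-α) := by
        field_simp [hs.1.ne']

theorem integral_sub_rpow_neg_mul_inv_le (hα : α < 1) (hε : ε ∈ Ioo 0 t) :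
    ∫ s in ε..t, (t - s) ^ (-α) * s⁻¹
      ≤ t ^ (-α) * (Real.log t - Real.log ε + 1 / (1 - α)) := by
  have ht : 0 < t := hε.1.trans hε.2
  have hα' : 0 < 1 - α := sub_pos.2 hα
  have kernel : IntervalIntegrable (fun s => (t - s) ^ (-α)) volume ε t :=
    intervalIntegrable_sub_rpow_neg hα
  have inv : ContinuousOn (fun s : ℝ => s⁻¹) (uIcc ε t) :=
    continuousOn_id.inv₀ fun s hs => (hε.1.trans_le (uIcc_of_le hε.2.le ▸ hs).1).ne'
  have tail_le : t⁻¹ * ((t - ε) ^ (1 - α) / (1 - α)) ≤ t ^ (-α) * (1 / (1 - α)) := by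
    rw [mul_one_div, ← mul_div_assoc]
    refine div_le_div_of_nonneg_right ((inv_mul_le_iff₀ ht).2 ?_) hα'.le
    rw [mul_comm, ← Real.rpow_add_one ht.ne', neg_add_eq_sub]
    exact Real.rpow_le_rpow (sub_pos.2 hε.2).le (by linarith [hε.1]) hα'.le
  calc ∫ s in ε..t, (t - s) ^ (-α) * s⁻¹
      ≤ ∫ s in ε..t, (t ^ (-α) * s⁻¹ + t⁻¹ * (t - s) ^ (-α)) :=
        intervalIntegral.integral_mono_on_of_le_Ioo hε.2.le (kernel.mul_continuousOn inv)
          ((inv.intervalIntegrable.const_mul _).add (kernel.const_mul _)) fun s hs =>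
            sub_rpow_neg_mul_inv_le hα.le ⟨hε.1.trans hs.1, hs.2⟩
    _ = t ^ (-α) * (Real.log t - Real.log ε) + t⁻¹ * ((t - ε) ^ (1 - α) / (1 - α)) := by
        rw [intervalIntegral.integral_add (inv.intervalIntegrable.const_mul _)
          (kernel.const_mul _), intervalIntegral.integral_const_mul,
          intervalIntegral.integral_const_mul, integral_inv_of_pos hε.1 ht,
          integral_sub_rpow_neg hα, Real.log_div ht.ne' hε.1.ne']
    _ ≤ t ^ (-α) * (Real.log t - Real.log ε + 1 / (1 - α)) := by linarith

theorem le_rlTrunc_sub_log {C : ℝ} (hα : α < 1) (hε : ε ∈ Ioo 0 t) :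
    (Real.Gamma (1 - α))⁻¹ * (t ^ (-α) * (C - Real.log t - 1 / (1 - α)))
      ≤ rlTrunc α (fun s => C - Real.log s) (fun s => -s⁻¹) t ε := by
  refine mul_le_mul_of_nonneg_left ?_ (inv_gamma_one_sub_pos hα).le
  simp only [smul_eq_mul, mul_neg, intervalIntegral.integral_neg]
  linarith [integral_sub_rpow_neg_mul_inv_le hα hε]

theorem hasLocalDensity_exp {μ T : ℝ} (hα : α < 1) :
    HasLocalDensity α T (fun s => Real.exp (μ * s)) fun s => μ * Real.exp (μ * s) :=
  .of_hasDerivAt hα (fun s _ => by simpa [mul_comm] using ((hasDerivAt_id' s).const_mul μ).exp)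
    (Continuous.continuousOn (by fun_prop))

theorem hasLocalDensity_sub_log {C T : ℝ} (hα : α < 1) :
    HasLocalDensity α T (fun s => C - Real.log s) fun s => -s⁻¹ :=
  .of_hasDerivAt hα (fun _ hs => (Real.hasDerivAt_log hs.1.ne').const_sub C)
    (continuousOn_id.inv₀ fun _ hs => hs.1.ne').neg

theorem log_sub_log_le_rpow_neg_mul {T : ℝ} (hα : 0 < α) (ht : 0 < t) (hT : 0 < T) :
    Real.log T - Real.log t ≤ t ^ (-α) * (T ^ α / α) := by
  have hTt : 0 < T / t := div_pos hT ht
  calc Real.log T - Real.log t = Real.log (T / t) := (Real.log_div hT.ne' ht.ne').symm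
    _ ≤ (T / t) ^ α / α := Real.log_le_rpow_div hTt.le hα
    _ = t ^ (-α) * (T ^ α / α) := by
      rw [Real.div_rpow hT.le ht.le, Real.rpow_neg ht.le]
      ring

/-- The barrier `exp (μ s) + (A + log (T / s))`: the logarithm blows up at time `0`, and the
exponential compensates for a negative coefficient `lam`. -/
noncomputable def expLogBarrier (μ A T s : ℝ) : ℝ :=
  Real.exp (μ * s) + (A + Real.log T - Real.log s)

theorem expLogBarrier_pos {μ A T : ℝ} (hA : 0 ≤ A) (ht : t ∈ Ioc 0 T) :
    0 < expLogBarrier μ A T t := by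
  have hlog : Real.log t ≤ Real.log T := Real.log_le_log ht.1 ht.2
  have hexp : 0 < Real.exp (μ * t) := Real.exp_pos _
  rw [expLogBarrier]
  linarith

theorem tendsto_expLogBarrier {μ A T : ℝ} : Tendsto (expLogBarrier μ A T) (𝓝[>] 0) atTop := by
  have hexp : Tendsto (fun s => Real.exp (μ * s)) (𝓝[>] 0) (𝓝 (Real.exp (μ * 0))) :=
    (Continuous.tendsto (by fun_prop) 0).mono_left nhdsWithin_le_nhds
  exact hexp.add_atTop (tendsto_atTop_add_const_left _ _
    (tendsto_neg_atBot_atTop.comp Real.tendsto_log_nhdsGT_zero))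

theorem hasLocalDensity_expLogBarrier {μ A T : ℝ} (hα : α < 1) :
    HasLocalDensity α T (expLogBarrier μ A T) fun s => μ * Real.exp (μ * s) + -s⁻¹ :=
  (hasLocalDensity_exp hα).add (hasLocalDensity_sub_log hα)

theorem le_rlTrunc_expLogBarrier {μ A T : ℝ} (hα : α ∈ Ico 0 1) (hμ : 0 < μ) (ht : t ∈ Ioc 0 T)
    (hε : ε ∈ Ioo 0 t) (hμε : μ * ε ≤ 1) :
    (Real.Gamma (1 - α))⁻¹ * (μ ^ α * Real.exp (μ * t)
        + t ^ (-α) * (A + Real.log T - Real.log t - 1 / (1 - α)))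
      ≤ rlTrunc α (expLogBarrier μ A T) (fun s => μ * Real.exp (μ * s) + -s⁻¹) t ε :=
  calc _ ≤ _ := by
        rw [mul_add]
        exact add_le_add (rpow_mul_exp_le_rlTrunc_exp hα hμ hε hμε) (le_rlTrunc_sub_log hα.2 hε)
    _ = _ := ((hasLocalDensity_exp hα.2).rlTrunc_add (hasLocalDensity_sub_log hα.2) ht hε).symm

theorem rpow_neg_add_mul_expLogBarrier_le {μ A G T : ℝ} (hα : 0 < α) (hμ : 0 ≤ μ) (hG : 0 ≤ G)
    (hA : 0 ≤ A) (hμG : G * (1 + A) ≤ μ ^ α) (hGA : 1 / (1 - α) + G * (T ^ α / α) + 1 ≤ A)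
    (ht : t ∈ Ioc 0 T) :
    t ^ (-α) + G * expLogBarrier μ A T t ≤ μ ^ α * Real.exp (μ * t)
      + t ^ (-α) * (A + Real.log T - Real.log t - 1 / (1 - α)) := by
  have hk : 0 ≤ t ^ (-α) := Real.rpow_nonneg ht.1.le _
  have hlog : 0 ≤ Real.log T - Real.log t := sub_nonneg.2 (Real.log_le_log ht.1 ht.2)
  have hexp : 1 ≤ Real.exp (μ * t) := Real.one_le_exp (mul_nonneg hμ ht.1.le)
  have exp_part : G * (Real.exp (μ * t) + A) ≤ μ ^ α * Real.exp (μ * t) :=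
    calc G * (Real.exp (μ * t) + A) ≤ G * (Real.exp (μ * t) + A * Real.exp (μ * t)) := by
          gcongr
          exact le_mul_of_one_le_right hA hexp
      _ = G * (1 + A) * Real.exp (μ * t) := by ring
      _ ≤ μ ^ α * Real.exp (μ * t) := by gcongr
  have log_part : t ^ (-α) + G * (Real.log T - Real.log t)
      ≤ t ^ (-α) * (A + (Real.log T - Real.log t) - 1 / (1 - α)) :=
    calc t ^ (-α) + G * (Real.log T - Real.log t)
        ≤ t ^ (-α) + G * (t ^ (-α) * (T ^ α / α)) := by
          gcongr
          exact log_sub_log_le_rpow_neg_mul hα ht.1 (ht.1.trans_le ht.2)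
      _ = t ^ (-α) * (1 + G * (T ^ α / α)) := by ring
      _ ≤ t ^ (-α) * (A + (Real.log T - Real.log t) - 1 / (1 - α)) := by
          gcongr
          linarith
  rw [expLogBarrier]
  linarith

theorem exists_isBarrier {T : ℝ} (hα : α ∈ Ioo 0 1) (lam : ℝ) (hT : 0 < T) :
    ∃ B B', IsBarrier α lam T B B' := by
  have hΓ : 0 < Real.Gamma (1 - α) := inv_pos.1 (inv_gamma_one_sub_pos hα.2)
  have hG : 0 ≤ Real.Gamma (1 - α) * |lam| := by positivity
  set A := 1 / (1 - α) + Real.Gamma (1 - α) * |lam| * (T ^ α / α) + 1 with hA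
  have hA0 : 0 ≤ A := by
    have := sub_pos.2 hα.2
    have := hα.1
    positivity
  obtain ⟨μ, hμG, hμ⟩ := (((tendsto_rpow_atTop hα.1).eventually_ge_atTop
    (Real.Gamma (1 - α) * |lam| * (1 + A))).and (eventually_gt_atTop 0)).exists
  refine ⟨expLogBarrier μ A T, _, hasLocalDensity_expLogBarrier hα.2,
    fun t => expLogBarrier_pos hA0, tendsto_expLogBarrier,
    fun t ht => ⟨(Real.Gamma (1 - α))⁻¹ * t ^ (-α),
      mul_pos (inv_pos.2 hΓ) (Real.rpow_pos_of_pos ht.1 _), ?_⟩⟩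
  filter_upwards [Ioo_mem_nhdsGT ht.1, Ioo_mem_nhdsGT (inv_pos.2 hμ)] with ε hε hεμ
  have rl_le := le_rlTrunc_expLogBarrier (A := A) ⟨hα.1.le, hα.2⟩ hμ ht hε
    ((le_inv_mul_iff₀ hμ).1 (by simpa using hεμ.2.le))
  have key := mul_le_mul_of_nonneg_left
    (rpow_neg_add_mul_expLogBarrier_le hα.1 hμ.le hG hA0 hμG hA.ge ht) (inv_pos.2 hΓ).le
  rw [mul_add, mul_assoc, inv_mul_cancel_left₀ hΓ.ne'] at key
  have hlam : -(|lam| * expLogBarrier μ A T t) ≤ lam * expLogBarrier μ A T t := by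
    rw [← neg_mul]
    exact mul_le_mul_of_nonneg_right (neg_abs_le lam) (expLogBarrier_pos hA0 ht).le
  linarith

end Barrier

section Comparison

theorem exists_touching_multiple {T M : ℝ} {F B : ℝ → ℝ} (hF : ContinuousOn F (Ioc 0 T))
    (hFM : ∀ t ∈ Ioc 0 T, F t ≤ M) (hB : ContinuousOn B (Ioc 0 T))
    (hBpos : ∀ t ∈ Ioc 0 T, 0 < B t) (hBtop : Tendsto B (𝓝[>] 0) atTop)
    {t₁ : ℝ} (ht₁ : t₁ ∈ Ioc 0 T) (hFt₁ : 0 < F t₁) :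
    ∃ t₀ ∈ Ioc 0 T, ∃ δ > 0, F t₀ = δ * B t₀ ∧ ∀ t ∈ Ioc 0 T, F t ≤ δ * B t := by
  have ratio_pos : 0 < F t₁ / B t₁ := div_pos hFt₁ (hBpos t₁ ht₁)
  obtain ⟨a, ha : 0 < a, hBa⟩ := (mem_nhdsGT_iff_exists_Ioo_subset' ht₁.1).1
    (hBtop.eventually_ge_atTop (M / (F t₁ / B t₁)))
  have hK : Icc (min a t₁) T ⊆ Ioc 0 T :=
    fun s hs => ⟨(lt_min ha ht₁.1).trans_le hs.1, hs.2⟩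
  obtain ⟨t₀, ht₀, hmax⟩ := isCompact_Icc.exists_isMaxOn ⟨t₁, min_le_right _ _, ht₁.2⟩
    ((hF.mono hK).div (hB.mono hK) fun t ht => (hBpos t (hK ht)).ne')
  have ratio_le : F t₁ / B t₁ ≤ F t₀ / B t₀ := hmax ⟨min_le_right _ _, ht₁.2⟩
  refine ⟨t₀, hK ht₀, F t₀ / B t₀, ratio_pos.trans_le ratio_le,
    (div_mul_cancel₀ _ (hBpos t₀ (hK ht₀)).ne').symm, fun t ht => ?_⟩
  rcases lt_or_ge t (min a t₁) with hlt | hge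
  · calc F t ≤ M := hFM t ht
      _ ≤ F t₁ / B t₁ * B t :=
        (div_le_iff₀' ratio_pos).1 (hBa ⟨ht.1, hlt.trans_le (min_le_left _ _)⟩)
      _ ≤ F t₀ / B t₀ * B t := mul_le_mul_of_nonneg_right ratio_le (hBpos t ht).le
  · exact (div_le_iff₀ (hBpos t ht)).1 (hmax ⟨hge, ht.2⟩)

variable {X : Type*} [NormedAddCommGroup X] [NormedSpace ℝ X] [CompleteSpace X] {α T t : ℝ}
  {e q D : ℝ → X} {E p DE B B' : ℝ → ℝ}

theorem mul_rlTrunc_le_of_touching {δ ε : ℝ} (hα : α ∈ Ico 0 1) (he : HasLocalDensity α T e q)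
    (hE : HasLocalDensity α T E p) (hB : HasLocalDensity α T B B') (l : X →L[ℝ] ℝ)
    (ht : t ∈ Ioc 0 T) (hε : ε ∈ Ioo 0 t) (hle : ∀ s ∈ Ioc 0 T, l (e s) ≤ E s + δ * B s)
    (heq : l (e t) = E t + δ * B t) :
    δ * rlTrunc α B B' t ε ≤ l (rlTrunc α e q t ε) - rlTrunc α E p t ε := by
  have hδB := hB.clm_comp (ContinuousLinearMap.mul ℝ ℝ δ)
  have hle := ((hE.add hδB).sub (he.clm_comp l)).rlTrunc_nonpos_of_touching hα ht.2 hε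
    (fun s hs => sub_nonneg.2 (hle s ⟨hs.1, hs.2.trans ht.2⟩)) (sub_eq_zero.2 heq.symm)
  rw [(hE.add hδB).rlTrunc_sub (he.clm_comp l) ht hε, hE.rlTrunc_add hδB ht hε,
    hB.rlTrunc_clm_comp _ ht hε, he.rlTrunc_clm_comp l ht hε] at hle
  rw [ContinuousLinearMap.mul_apply'] at hle
  linarith

theorem norm_le_of_forall_exists_dual {lam M : ℝ} (hα : α ∈ Ioo 0 1)
    (he : HasLocalDensity α T e q) (hE : HasLocalDensity α T E p)
    (hM : ∀ t ∈ Ioc 0 T, ‖e t‖ ≤ M) (hE_nonneg : ∀ t ∈ Ioc 0 T, 0 ≤ E t)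
    (hD : ∀ t ∈ Ioc 0 T, Tendsto (rlTrunc α e q t) (𝓝[>] 0) (𝓝 (D t)))
    (hDE : ∀ t ∈ Ioc 0 T, Tendsto (rlTrunc α E p t) (𝓝[>] 0) (𝓝 (DE t)))
    (hdual : ∀ t ∈ Ioc 0 T, e t ≠ 0 → ∃ l : X →L[ℝ] ℝ, ‖l‖ ≤ 1 ∧ l (e t) = ‖e t‖ ∧
      l (D t) + lam * ‖e t‖ ≤ DE t + lam * E t) (ht : t ∈ Ioc 0 T) : ‖e t‖ ≤ E t := by
  by_contra! hlt
  obtain ⟨B, B', hB⟩ := exists_isBarrier hα lam (ht.1.trans_le ht.2)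
  obtain ⟨t₀, ht₀, δ, hδ, heq, hle⟩ := exists_touching_multiple
    (F := fun s => ‖e s‖ - E s) (he.continuousOn.norm.sub hE.continuousOn)
    (fun s hs => (sub_le_self _ (hE_nonneg s hs)).trans (hM s hs))
    hB.hasLocalDensity.continuousOn hB.pos hB.tendsto_atTop ht (sub_pos.2 hlt)
  have hδB : 0 < δ * B t₀ := mul_pos hδ (hB.pos t₀ ht₀)
  have he₀ : e t₀ ≠ 0 := norm_pos_iff.1 (by linarith [hE_nonneg t₀ ht₀])
  obtain ⟨l, hl, hle₀, hlD⟩ := hdual t₀ ht₀ he₀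
  obtain ⟨c, hc, hcB⟩ := hB.supersolution t₀ ht₀
  have limit_le : δ * (c - lam * B t₀) ≤ l (D t₀) - DE t₀ := by
    refine ge_of_tendsto (((l.continuous.tendsto _).comp (hD t₀ ht₀)).sub (hDE t₀ ht₀)) ?_
    filter_upwards [hcB, Ioo_mem_nhdsGT ht₀.1] with ε hcε hε
    calc δ * (c - lam * B t₀) ≤ δ * rlTrunc α B B' t₀ ε := by
          gcongr
          linarith
      _ ≤ l (rlTrunc α e q t₀ ε) - rlTrunc α E p t₀ ε :=
        mul_rlTrunc_le_of_touching ⟨hα.1.le, hα.2⟩ he hE hB.hasLocalDensity l ht₀ hε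
          (fun s hs => by linarith [hle s hs, (le_abs_self _).trans (l.le_of_opNorm_le hl (e s))])
          (by linarith)
  have hδc : 0 < δ * c := mul_pos hδ hc
  have hlam : lam * ‖e t₀‖ = lam * (E t₀ + δ * B t₀) := by rw [← heq, add_sub_cancel]
  linarith

end Comparison

section Residual

variable {H : Type*} [NormedAddCommGroup H] [InnerProductSpace ℝ H] {α T t : ℝ}

theorem TimeRegular.tendsto_rlTrunc_sub [CompleteSpace H] {u w : ℝ → H} (hα : α < 1)
    (hw : TimeRegular T w) (hu : TimeRegular T u) (ht : t ∈ Ioc 0 T) :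
    Tendsto (rlTrunc α (w - u) (deriv w - deriv u) t) (𝓝[>] 0)
      (𝓝 (caputoDeriv α w t - caputoDeriv α u t
        + ((Real.Gamma (1 - α))⁻¹ * t ^ (-α)) • (w 0 - u 0))) := by
  rw [smul_sub, ← add_sub_add_comm]
  refine ((tendsto_rlTrunc_of_caputoTrunc (hw.tendsto_caputoTrunc hα ht)).sub
    (tendsto_rlTrunc_of_caputoTrunc (hu.tendsto_caputoTrunc hα ht))).congr' ?_
  filter_upwards [Ioo_mem_nhdsGT ht.1] with ε hε
  exact ((hw.hasLocalDensity hα).rlTrunc_sub (hu.hasLocalDensity hα) ht hε).symm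

theorem hasLocalDensity_of_hasCaputoDeriv {E : ℝ → ℝ}
    (hE : ∀ ε ∈ Ioc 0 T, AbsolutelyContinuousOnInterval E ε T)
    (hD : ∀ t ∈ Ioc 0 T, ∃ D, HasCaputoDeriv α E t D) : HasLocalDensity α T E (deriv E) where
  hasDensityOn ε hε := .of_absolutelyContinuousOnInterval (hE ε hε)
  intervalIntegrable t ht := (hD t ht).choose_spec.1

theorem exists_dual_add_mul_norm_le {x y : H} {lam r : ℝ} (hx : x ≠ 0)
    (h : ⟪x, y⟫_ℝ + lam * ‖x‖ ^ 2 ≤ r * ‖x‖) :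
    ∃ l : H →L[ℝ] ℝ, ‖l‖ ≤ 1 ∧ l x = ‖x‖ ∧ l y + lam * ‖x‖ ≤ r := by
  have hx' : 0 < ‖x‖ := norm_pos_iff.2 hx
  refine ⟨‖x‖⁻¹ • innerSL ℝ x, ?_, ?_, ?_⟩
  · rw [norm_smul, innerSL_apply_norm, norm_inv, norm_norm, inv_mul_cancel₀ hx'.ne']
  · rw [smul_apply, innerSL_apply_apply, real_inner_self_eq_norm_sq, smul_eq_mul, pow_two,
      inv_mul_cancel_left₀ hx'.ne']
  · rw [smul_apply, innerSL_apply_apply, smul_eq_mul, ← mul_le_mul_iff_left₀ hx']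
    calc (‖x‖⁻¹ * ⟪x, y⟫_ℝ + lam * ‖x‖) * ‖x‖ = ⟪x, y⟫_ℝ + lam * ‖x‖ ^ 2 := by field_simp
      _ ≤ r * ‖x‖ := h

theorem inner_add_mul_sq_le_norm_mul {V : Type*} [AddCommGroup V] [Module ℝ V]
    [TopologicalSpace V] {ι : V →L[ℝ] H} {L : V → V →L[ℝ] ℝ} {f : V →L[ℝ] ℝ} {lam : ℝ} {U W : V}
    {Du Dw R : H}
    (hL : lam * ‖ι (W - U)‖ ^ 2 ≤ (L W - L U) (W - U))
    (hu : (innerSL ℝ Du).comp ι + L U = f)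
    (hw : (innerSL ℝ R).comp ι = (innerSL ℝ Dw).comp ι + L W - f) :
    ⟪ι (W - U), Dw - Du⟫_ℝ + lam * ‖ι (W - U)‖ ^ 2 ≤ ‖R‖ * ‖ι (W - U)‖ := by
  have hdiff : (innerSL ℝ R).comp ι = (innerSL ℝ (Dw - Du)).comp ι + (L W - L U) := by
    rw [hw, ← hu, map_sub, ContinuousLinearMap.sub_comp]
    abel
  have heq := DFunLike.congr_fun hdiff (W - U)
  simp only [add_apply, ContinuousLinearMap.comp_apply,
    innerSL_apply_apply] at heq
  rw [real_inner_comm]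
  linarith [real_inner_le_norm R (ι (W - U))]

theorem corollary1_general {V H : Type*} [AddCommGroup V] [Module ℝ V] [TopologicalSpace V]
    [NormedAddCommGroup H] [InnerProductSpace ℝ H] [CompleteSpace H] {α T lam : ℝ}
    (hα : α ∈ Ioo 0 1) (ι : V →L[ℝ] H) (L : V → V →L[ℝ] ℝ)
    (hL : ∀ v w, lam * ‖ι (v - w)‖ ^ 2 ≤ (L v - L w) (v - w)) {f : ℝ → V →L[ℝ] ℝ}
    {u uh R : ℝ → H} (hu_reg : TimeRegular T u) (huh_reg : TimeRegular T uh)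
    (hu : ∀ t ∈ Ioc 0 T, ∃ U, ι U = u t ∧ (innerSL ℝ (caputoDeriv α u t)).comp ι + L U = f t)
    (hR : ∀ t ∈ Ioc 0 T, ∃ W, ι W = uh t ∧
      (innerSL ℝ (R t)).comp ι = (innerSL ℝ (caputoDeriv α uh t)).comp ι + L W - f t)
    {E : ℝ → ℝ} (hE_zero : ‖uh 0 - u 0‖ ≤ E 0) (hE_nonneg : ∀ t ∈ Ioc 0 T, 0 ≤ E t)
    (hE_ac : ∀ ε ∈ Ioc 0 T, AbsolutelyContinuousOnInterval E ε T)
    (hE_caputo : ∀ t ∈ Ioc 0 T, ∃ D : ℝ, HasCaputoDeriv α E t D)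
    (hRE : ∀ t ∈ Ioc 0 T, ‖R t‖ ≤ caputoDeriv α E t + lam * E t) :
    ∀ t ∈ Icc 0 T, ‖uh t - u t‖ ≤ E t := by
  rintro t ⟨ht0, htT⟩
  rcases ht0.eq_or_lt with rfl | ht0
  · exact hE_zero
  obtain ⟨Mu, hMu⟩ := hu_reg.exists_norm_le
  obtain ⟨Mh, hMh⟩ := huh_reg.exists_norm_le
  have hDE : ∀ s ∈ Ioc 0 T, Tendsto (caputoTrunc α E s) (𝓝[>] 0) (𝓝 (caputoDeriv α E s)) :=
    fun s hs => tendsto_nhds_limUnder ((hE_caputo s hs).imp fun _ h => h.2)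
  suffices hdual : ∀ s ∈ Ioc 0 T, (uh - u) s ≠ 0 → ∃ l : H →L[ℝ] ℝ,
      ‖l‖ ≤ 1 ∧ l ((uh - u) s) = ‖(uh - u) s‖ ∧
      l (caputoDeriv α uh s - caputoDeriv α u s
          + ((Real.Gamma (1 - α))⁻¹ * s ^ (-α)) • (uh 0 - u 0)) + lam * ‖(uh - u) s‖
        ≤ caputoDeriv α E s + ((Real.Gamma (1 - α))⁻¹ * s ^ (-α)) • E 0 + lam * E s from
    norm_le_of_forall_exists_dual hα
      ((huh_reg.hasLocalDensity hα.2).sub (hu_reg.hasLocalDensity hα.2))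
      (hasLocalDensity_of_hasCaputoDeriv hE_ac hE_caputo)
      (fun s hs => norm_sub_le_of_le (hMh s hs) (hMu s hs)) hE_nonneg
      (fun s => huh_reg.tendsto_rlTrunc_sub hα.2 hu_reg)
      (fun s hs => tendsto_rlTrunc_of_caputoTrunc (hDE s hs)) hdual ⟨ht0, htT⟩
  intro s hs hne
  obtain ⟨U, hU, hu⟩ := hu s hs
  obtain ⟨W, hW, hR⟩ := hR s hs
  have hι : ι (W - U) = (uh - u) s := by rw [map_sub, hW, hU, Pi.sub_apply]
  obtain ⟨l, hl, hle, hlD⟩ :=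
    exists_dual_add_mul_norm_le hne (hι ▸ inner_add_mul_sq_le_norm_mul (hL W U) hu hR)
  have initial_le : (Real.Gamma (1 - α))⁻¹ * s ^ (-α) * l (uh 0 - u 0)
      ≤ (Real.Gamma (1 - α))⁻¹ * s ^ (-α) * E 0 :=
    mul_le_mul_of_nonneg_left
      ((le_abs_self _).trans ((l.le_of_opNorm_le hl _).trans ((one_mul _).trans_le hE_zero)))
      (mul_nonneg (inv_gamma_one_sub_pos hα.2).le (Real.rpow_nonneg hs.1.le _))
  refine ⟨l, hl, hle, ?_⟩
  rw [map_add, map_smul, smul_eq_mul, smul_eq_mul]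
  linarith [hRE s hs]

end Residual

theorem corollary1 {d : ℕ} (Ω : Set (EuclideanSpace ℝ (Fin d))) (hΩ : IsOpen Ω)
    (α T lam : ℝ) (hα : α ∈ Ioo (0 : ℝ) 1) (hT : 0 < T)
    (L : H01 Ω →L[ℝ] Hneg1 Ω)
    (hL : ∀ v : H01 Ω, lam * ‖H01.toL2 Ω v‖ ^ 2 ≤ L v v)
    (f : ℝ → Hneg1 Ω) (u₀ : L2 Ω) (u uh R : ℝ → L2 Ω)
    (hu_reg : TimeRegular T u) (huh_reg : TimeRegular T uh)
    (hu : IsSolution α T L f u₀ u)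
    (huh_zero : uh 0 = u₀) (hR : IsResidual α T L f uh R)
    (E : ℝ → ℝ) (hE_nonneg : ∀ t ∈ Icc 0 T, 0 ≤ E t)
    (hE_ac : ∀ ε ∈ Ioc 0 T, AbsolutelyContinuousOnInterval E ε T)
    (hE_caputo : ∀ t ∈ Ioc 0 T, ∃ D : ℝ, HasCaputoDeriv α E t D)
    (hRE : ∀ t ∈ Ioc 0 T, ‖R t‖ ≤ caputoDeriv α E t + lam * E t) :
    ∀ t ∈ Icc 0 T, ‖uh t - u t‖ ≤ E t := by
  exact corollary1_general hα (H01.toL2 Ω) L (fun v w => by simpa only [map_sub] using hL (v - w))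
    hu_reg huh_reg hu.2 hR (by simpa [huh_zero, hu.1] using hE_nonneg 0 (left_mem_Icc.2 hT.le))
    (fun t ht => hE_nonneg t (Ioc_subset_Icc_self ht)) hE_ac hE_caputo hRE
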